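/- Let $G$ be a nontrivial finite group. In the three-player game \emph{Do Not Generate} on $G$, Players 1, 2, 3 take turns cyclically (Player 1 first) selecting previously unselected elements of $G$. The game ends as soon as the jointly selected elements generate $G$: the player who made that last selection loses, the player who moves immediately before the loser in the cyclic order is the winner, and the remaining player is the runner-up. Every player prefers winning to being the runner-up and being the runner-up to losing. We say that Player $i$ \emph{has a winning strategy} if Player $i$ wins under rational play, that is, if the game has a subgame perfect equilibrium and Player $i$ wins in every subgame perfect equilibrium. For a finite group $X$ let $d(X)$ be the least size of a generating set of $X$. Let $G$ be a nontrivial finite nilpotent group, let $H$ be the (internal direct) product of the Sylow $q$-subgroups of $G$ over the primes $q \equiv 1 \pmod 3$, and let $K$ be the product of the Sylow $r$-subgroups of $G$ over the primes $r \equiv 2 \pmod 3$. 1. Player 1 has a winning strategy in each of the following cases: (a) $|G| \equiv 1 \pmod 3$ and $2d(H) \ge d(K)+1$; (b) $|G| \equiv 2 \pmod 3$ and $2d(K) \ge d(H)+1$; (c) $|G| \equiv 3 \pmod 9$ and $d(G) = 1$. 2. Player 2 has a winning strategy in each of the following cases: (a) $|G| \equiv 1 \pmod 3$ and $2d(H)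 < d(K)+1$; (b) $|G| \equiv 2 \pmod 3$ and $2d(K) < d(H)+1$; (c) $|G| \equiv 6 \pmod 9$ and $d(G) \le 2$. 3. Player 3 has a winning strategy in each of the following cases: (a) $|G| \equiv 0 \pmod 9$; (b) $|G| \equiv 3 \pmod 9$ and $d(G) \ge 2$; (c) $|G| \equiv 6 \pmod 9$ and $d(G) \ge 3$. -/

import Mathlib

namespace DoNotGenerate

/-- The three players: Player `k` is the residue class of `k` modulo `3`
(so Player 3 is `3 = 0`), and they move in the cyclic order `1, 2, 3, 1, 2, 3, …`. -/
abbrev Player : Type := ZMod 3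

/-- A history of a game that is still running: the list of the elements selected so far (latest
first), without repetitions, which do not jointly generate the group. -/
structure Position (G : Type*) [Group G] where
  selected : List G
  nodup : selected.Nodup
  not_generating : Subgroup.closure {x | x ∈ selected} ≠ ⊤

namespace Position

variable {G : Type*} [Group G]

/-- The beginning of the game: nothing has been selected. -/
def start (G : Type*) [Group G] [Nontrivial G] : Position G where
  selected := []
  nodup := List.nodup_nil
  not_generating := by simp [bot_ne_top]

/-- The player to move: after `n` selections this is Player `n + 1` (cyclically). -/
def toMove (h : Position G) : Player := (h.selected.length : ZMod 3) + 1

/-- The position after a legal selection that does not generate the group. -/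
def extend (h : Position G) (x : G) (hx : x ∉ h.selected)
    (hgen : Subgroup.closure {y | y ∈ x :: h.selected} ≠ ⊤) : Position G where
  selected := x :: h.selected
  nodup := List.nodup_cons.2 ⟨hx, h.nodup⟩
  not_generating := hgen

theorem extend_measure_lt [Finite G] (h : Position G) (x : G) (hx : x ∉ h.selected)
    (hgen : Subgroup.closure {y | y ∈ x :: h.selected} ≠ ⊤) :
    Nat.card G - (h.extend x hx hgen).selected.length < Nat.card G - h.selected.length := by
  have := Fintype.ofFinite G
  have h1 := (h.extend x hx hgen).nodup.length_le_card
  rw [← Nat.card_eq_fintype_card] at h1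
  simp only [extend, List.length_cons] at h1 ⊢
  omega

end Position

/-- A strategy chooses, at every history of a running game, a previously unselected element
(which may be one that completes a generating set). Only the choices at the positions where it is
the owner's turn are ever used. -/
structure Strategy (G : Type*) [Group G] where
  move : Position G → G
  legal : ∀ h : Position G, move h ∉ h.selected

/-- A strategy for each of the three players. -/
abbrev Profile (G : Type*) [Group G] : Type _ := Player → Strategy G

open Classical in
/-- The winner when the game is continued from the position `h` and all players follow `σ`.
The player whose selection completes a generating set loses, and the player who moves immediately
before the loser (in cyclic order) is the winner. -/
noncomputable def winner {G : Type*} [Group G] [Finite G] (σ : Profile G) (h : Position G) :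
    Player :=
  if hgen : Subgroup.closure {y | y ∈ (σ h.toMove).move h :: h.selected} = ⊤ then
    h.toMove - 1
  else
    winner σ (h.extend ((σ h.toMove).move h) ((σ h.toMove).legal h) hgen)
termination_by Nat.card G - h.selected.length
decreasing_by exact h.extend_measure_lt _ _ _

/-- How player `i` ranks the outcome of a game won by `w`: winning is best (`2`), being the
runner-up is second best (`1`), losing is worst (`0`). The loser is `w + 1`, so the runner-up, the
remaining player, is `w - 1`. -/
def payoff (i w : Player) : ℕ :=
  if i = w then 2 else if i = w - 1 then 1 else 0

/-- All players play rationally: at no position, reached or not, can a player obtain an outcome she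
prefers by changing her own strategy (subgame perfect equilibrium). -/
def IsRational {G : Type*} [Group G] [Finite G] (σ : Profile G) : Prop :=
  ∀ (h : Position G) (i : Player) (τ : Strategy G),
    payoff i (winner (Function.update σ i τ) h) ≤ payoff i (winner σ h)

/-- Player `i` has a winning strategy in the three-player game *Do Not Generate* on `G`, where every
player helps her preferred opponent if she cannot win herself: rational play exists, and `i` wins
whenever everybody plays rationally. -/
def HasWinningStrategy (G : Type*) [Group G] [Finite G] [Nontrivial G] (i : Player) : Prop :=
  (∃ σ : Profile G, IsRational σ) ∧
    ∀ σ : Profile G, IsRational σ → winner σ (Position.start G) = i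

/-- The product in `G` of all Sylow `q`-subgroups of `G` for the primes `q ≡ c (mod 3)`. -/
def sylowProduct (G : Type*) [Group G] (c : ℕ) : Subgroup G :=
  ⨆ (q : ℕ) (_ : q.Prime) (_ : q ≡ c [MOD 3]) (P : Sylow q G), (P : Subgroup G)

end DoNotGenerate

/-!
The game ends when the selected elements exhaust a maximal subgroup `M`: the next selection then
loses, so the winner is the player `|M|` modulo `3`. Backward induction gives all subgame perfect
equilibria the same winner.

A maximal subgroup of a nilpotent group has prime index, and it contains one of the two factors `A`
and `B` of any decomposition into complementary Hall subgroups. Splitting the primes by their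
residue modulo `3`, or splitting off the prime `3` when it divides `|G|` exactly once, makes `|M|`
modulo `3` depend only on which factor `M` contains, say `a` for `A` and `a + 1` for `B`. So the
game is a race to complete `A` or `B`. The players `a - 1` and `a` both prefer the winner `a` to the
winner `a + 1`, hence two selections for `A` alternate with one for `B`, and comparing `d(A)` with
`2 d(B)` decides the race.
-/

namespace DoNotGenerate

open Subgroup

section HallPair

variable {G : Type*} [Group G] {A B C D : Subgroup G}

/-- Two normal subgroups of coprime orders whose product is the whole group: complementary normal
Hall subgroups, when the group is finite. -/
structure IsHallPair (A B : Subgroup G) : Prop where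
  normal_left : A.Normal
  normal_right : B.Normal
  coprime : (Nat.card A).Coprime (Nat.card B)
  sup_eq_top : A ⊔ B = ⊤

theorem isHallPair_top_bot : IsHallPair (⊤ : Subgroup G) ⊥ where
  normal_left := inferInstance
  normal_right := inferInstance
  coprime := by simp
  sup_eq_top := top_sup_eq _

namespace IsHallPair

theorem symm (h : IsHallPair A B) : IsHallPair B A :=
  ⟨h.normal_right, h.normal_left, h.coprime.symm, sup_comm A B ▸ h.sup_eq_top⟩

theorem commute (h : IsHallPair A B) {a b : G} (ha : a ∈ A) (hb : b ∈ B) : Commute a b :=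
  commute_of_normal_of_disjoint A B h.normal_left h.normal_right
    (disjoint_of_coprime_natCard h.coprime) a b ha hb

theorem exists_mul_eq (h : IsHallPair A B) (x : G) : ∃ a ∈ A, ∃ b ∈ B, a * b = x := by
  have := h.normal_right
  exact mem_sup_of_normal_right.1 (h.sup_eq_top ▸ mem_top x)

-- By the Chinese remainder theorem, `e` may be `1` modulo `|A|` and `0` modulo `|B|`.
theorem exists_mul_pow_eq (h : IsHallPair A B) : ∃ e : ℕ, ∀ a ∈ A, ∀ b ∈ B, (a * b) ^ e = a := by
  obtain ⟨e, heA, heB⟩ := Nat.chineseRemainder h.coprime 1 0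
  refine ⟨e, fun a ha b hb => ?_⟩
  have hae : a ^ e = a ^ 1 :=
    pow_eq_pow_iff_modEq.2 (heA.of_dvd (A.orderOf_dvd_natCard ha))
  have hbe : b ^ e = b ^ 0 :=
    pow_eq_pow_iff_modEq.2 (heB.of_dvd (B.orderOf_dvd_natCard hb))
  rw [(h.commute ha hb).mul_pow, hae, hbe, pow_one, pow_zero, mul_one]

theorem zpowers_le_zpowers_mul (h : IsHallPair A B) {a b : G} (ha : a ∈ A) (hb : b ∈ B) :
    zpowers a ≤ zpowers (a * b) := by
  obtain ⟨e, he⟩ := h.exists_mul_pow_eq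
  have hmem : (a * b) ^ e ∈ zpowers (a * b) := npow_mem_zpowers _ _
  rwa [he a ha b hb, ← zpowers_le] at hmem

theorem le_of_le_sup (h : IsHallPair A B) (hD : D ≤ B) (hle : A ≤ C ⊔ D) : A ≤ C := by
  have := h.normal_right
  obtain ⟨e, he⟩ := h.exists_mul_pow_eq
  intro a ha
  obtain ⟨c, hc, b, hb, rfl⟩ := mem_sup_of_normal_right.1 (sup_le_sup_left hD C (hle ha))
  have hpow : c ^ e = c * b := by
    simpa only [mul_inv_cancel_right] using he (c * b) ha b⁻¹ (inv_mem hb)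
  exact hpow ▸ pow_mem hc e

theorem le_or_le_of_isCoatom (h : IsHallPair A B) {M : Subgroup G} (hM : IsCoatom M) :
    A ≤ M ∨ B ≤ M := by
  refine or_iff_not_imp_right.2 fun hB => h.le_of_le_sup le_rfl ?_
  exact le_top.trans_eq (hM.2 _ (left_lt_sup.2 hB)).symm

end IsHallPair

end HallPair

section RelRank

variable {G : Type*} [Group G] {A B C D : Subgroup G}

/-- The least number of elements which, together with `C`, generate a subgroup containing `A`: the
number of selections still needed to complete `A` once `C` has been generated. -/
noncomputable def relRank (A C : Subgroup G) : ℕ :=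
  sInf {n | ∃ T : Finset G, T.card = n ∧ A ≤ C ⊔ closure (T : Set G)}

theorem relRank_le_card {T : Finset G} (hT : A ≤ C ⊔ closure (T : Set G)) : relRank A C ≤ T.card :=
  Nat.sInf_le ⟨T, rfl, hT⟩

variable [Finite G]

theorem exists_card_eq_relRank (A C : Subgroup G) :
    ∃ T : Finset G, T.card = relRank A C ∧ A ≤ C ⊔ closure (T : Set G) := by
  have := Fintype.ofFinite G
  have huniv : A ≤ C ⊔ closure ((Finset.univ : Finset G) : Set G) := by simp
  exact Nat.sInf_mem (s := {n | ∃ T : Finset G, T.card = n ∧ A ≤ C ⊔ closure (T : Set G)})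
    ⟨_, Finset.univ, rfl, huniv⟩

theorem relRank_eq_zero_iff : relRank A C = 0 ↔ A ≤ C := by
  refine ⟨fun h => ?_, fun h => ?_⟩
  · obtain ⟨T, hcard, hT⟩ := exists_card_eq_relRank A C
    obtain rfl : T = ∅ := Finset.card_eq_zero.1 (hcard.trans h)
    simpa using hT
  · exact Nat.le_zero.1 (relRank_le_card (T := ∅) (by simpa using h))

theorem relRank_mono_left (h : A ≤ B) : relRank A C ≤ relRank B C := by
  obtain ⟨T, hcard, hT⟩ := exists_card_eq_relRank B C
  exact hcard ▸ relRank_le_card (h.trans hT)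

theorem relRank_anti_right (h : C ≤ D) : relRank A D ≤ relRank A C := by
  obtain ⟨T, hcard, hT⟩ := exists_card_eq_relRank A C
  exact hcard ▸ relRank_le_card (hT.trans (sup_le_sup_right h _))

theorem relRank_le_relRank_sup_zpowers_add_one (A C : Subgroup G) (x : G) :
    relRank A C ≤ relRank A (C ⊔ zpowers x) + 1 := by
  classical
  obtain ⟨T, hcard, hT⟩ := exists_card_eq_relRank A (C ⊔ zpowers x)
  rw [← hcard]
  refine (relRank_le_card (T := insert x T) ?_).trans (Finset.card_insert_le x T)
  rwa [Finset.coe_insert, Set.insert_eq, Subgroup.closure_union, ← zpowers_eq_closure, ← sup_assoc]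

theorem exists_relRank_sup_zpowers_le (A C : Subgroup G) :
    ∃ x, relRank A (C ⊔ zpowers x) ≤ relRank A C - 1 := by
  classical
  obtain ⟨T, hcard, hT⟩ := exists_card_eq_relRank A C
  obtain rfl | ⟨x, hx⟩ := T.eq_empty_or_nonempty
  · rw [← hcard]
    exact ⟨1, (relRank_anti_right le_sup_left).trans hcard.ge⟩
  · refine ⟨x, ?_⟩
    rw [← hcard, ← Finset.card_erase_of_mem hx]
    refine relRank_le_card ?_
    rwa [sup_assoc, zpowers_eq_closure, ← Subgroup.closure_union, ← Set.insert_eq,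
      ← Finset.coe_insert, Finset.insert_erase hx]

theorem relRank_bot_le_rank (A : Subgroup G) : relRank A ⊥ ≤ Group.rank A := by
  classical
  obtain ⟨S, hcard, hS⟩ := Group.rank_spec A
  rw [← hcard, ← Finset.card_map (Function.Embedding.subtype (· ∈ A))]
  refine relRank_le_card ?_
  rw [bot_sup_eq, Finset.coe_map]
  change A ≤ closure (A.subtype '' S)
  rw [← MonoidHom.map_closure, hS, ← MonoidHom.range_eq_map, range_subtype]

namespace IsHallPair

theorem relRank_sup_eq (h : IsHallPair A B) (hD : D ≤ B) : relRank A (C ⊔ D) = relRank A C := by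
  refine (relRank_anti_right le_sup_left).antisymm ?_
  obtain ⟨T, hcard, hT⟩ := exists_card_eq_relRank A (C ⊔ D)
  exact hcard ▸ relRank_le_card (h.le_of_le_sup hD (by rwa [sup_right_comm] at hT))

theorem exists_mem_relRank_sup_zpowers_le (h : IsHallPair A B) (C : Subgroup G) :
    ∃ a ∈ A, relRank A (C ⊔ zpowers a) ≤ relRank A C - 1 := by
  obtain ⟨x, hx⟩ := exists_relRank_sup_zpowers_le A C
  obtain ⟨a, ha, b, hb, rfl⟩ := h.exists_mul_eq x
  refine ⟨a, ha, le_trans ?_ hx⟩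
  rw [← h.relRank_sup_eq (zpowers_le.2 hb), sup_assoc]
  refine relRank_anti_right (sup_le_sup_left (zpowers_le.2 ?_) C)
  exact mul_mem (mem_sup_left (mem_zpowers a)) (mem_sup_right (mem_zpowers b))

theorem relRank_bot (h : IsHallPair A B) : relRank A ⊥ = Group.rank A := by
  classical
  refine (relRank_bot_le_rank A).antisymm ?_
  obtain ⟨T, hcard, hT⟩ := exists_card_eq_relRank A ⊥
  rw [bot_sup_eq] at hT
  obtain ⟨e, he⟩ := h.exists_mul_pow_eq
  let S : Finset G := T.image (· ^ e)
  have hSA : closure (S : Set G) ≤ A := by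
    rw [closure_le, Finset.coe_image, Set.image_subset_iff]
    intro x _
    obtain ⟨a, ha, b, hb, rfl⟩ := h.exists_mul_eq x
    simpa only [Set.mem_preimage, he a ha b hb, SetLike.mem_coe] using ha
  have hTS : closure (T : Set G) ≤ closure (S : Set G) ⊔ B := by
    rw [closure_le]
    intro x hx
    obtain ⟨a, ha, b, hb, rfl⟩ := h.exists_mul_eq x
    have haS : a ∈ closure (S : Set G) :=
      he a ha b hb ▸ subset_closure (Finset.mem_image_of_mem (· ^ e) hx)
    exact mul_mem (mem_sup_left haS) (mem_sup_right hb)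
  have hS : closure (S : Set G) = A := hSA.antisymm (h.le_of_le_sup le_rfl (hT.trans hTS))
  calc Group.rank A = Group.rank (closure (S : Set G)) := rank_congr hS.symm
    _ ≤ S.card := rank_closure_finset_le_card S
    _ ≤ relRank A ⊥ := hcard ▸ Finset.card_image_le

theorem relRank_top_le (h : IsHallPair A B) {n : ℕ} (hA : relRank A C ≤ n) (hB : relRank B C ≤ n) :
    relRank ⊤ C ≤ n := by
  induction n generalizing C with
  | zero =>
    rw [Nat.le_zero, relRank_eq_zero_iff] at hA hB ⊢
    exact h.sup_eq_top.ge.trans (sup_le hA hB)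
  | succ n ih =>
    obtain ⟨a, ha, hCa⟩ := h.exists_mem_relRank_sup_zpowers_le C
    obtain ⟨b, hb, hCb⟩ := h.symm.exists_mem_relRank_sup_zpowers_le C
    have haab := h.zpowers_le_zpowers_mul ha hb
    have hbab : zpowers b ≤ zpowers (a * b) :=
      (h.commute ha hb).eq ▸ h.symm.zpowers_le_zpowers_mul hb ha
    have hAn : relRank A (C ⊔ zpowers (a * b)) ≤ n :=
      (relRank_anti_right (sup_le_sup_left haab C)).trans (by omega)
    have hBn : relRank B (C ⊔ zpowers (a * b)) ≤ n :=
      (relRank_anti_right (sup_le_sup_left hbab C)).trans (by omega)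
    exact (relRank_le_relRank_sup_zpowers_add_one ⊤ C (a * b)).trans
      (Nat.succ_le_succ (ih hAn hBn))

theorem rank_eq_max (h : IsHallPair A B) : Group.rank G = max (Group.rank A) (Group.rank B) := by
  have htop : Group.rank G = relRank (⊤ : Subgroup G) ⊥ := by
    rw [isHallPair_top_bot.relRank_bot, Group.rank_congr topEquiv]
  rw [htop, ← h.relRank_bot, ← h.symm.relRank_bot]
  exact (h.relRank_top_le (le_max_left _ _) (le_max_right _ _)).antisymm
    (max_le (relRank_mono_left le_top) (relRank_mono_left le_top))

end IsHallPair

end RelRank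

section HallProduct

variable {G : Type*} [Group G]

/-- The product of all Sylow `q`-subgroups of `G` for the primes `q` satisfying `c`. For
`c = (· ≡ k [MOD 3])` it is definitionally `sylowProduct G k`. -/
def hallProduct (G : Type*) [Group G] (c : ℕ → Prop) : Subgroup G :=
  ⨆ (q : ℕ) (_ : q.Prime) (_ : c q) (P : Sylow q G), (P : Subgroup G)

theorem hallProduct_le_iff {c : ℕ → Prop} {L : Subgroup G} :
    hallProduct G c ≤ L ↔ ∀ q : ℕ, q.Prime → c q → ∀ P : Sylow q G, (P : Subgroup G) ≤ L := by
  simp only [hallProduct, iSup_le_iff]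

theorem not_dvd_card_sup {p : ℕ} {M N : Subgroup G} [M.Normal] (hp : p.Prime)
    (hM : ¬ p ∣ Nat.card M) (hN : ¬ p ∣ Nat.card N) : ¬ p ∣ Nat.card (M ⊔ N : Subgroup G) := by
  rw [← relIndex_bot_left, ← relIndex_mul_relIndex ⊥ M _ bot_le le_sup_left, relIndex_sup_left,
    relIndex_bot_left, hp.dvd_mul]
  exact fun h => h.elim hM fun h => hN (h.trans (M.relIndex_dvd_card N))

variable [Finite G] {p : ℕ} {c c' : ℕ → Prop}

theorem not_dvd_index_of_hallProduct_le {L : Subgroup G} (hL : hallProduct G c ≤ L)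
    (hp : p.Prime) (hc : c p) : ¬ p ∣ L.index := by
  have := Fact.mk hp
  let P : Sylow p G := default
  have hP : (P : Subgroup G) ≤ L := hallProduct_le_iff.1 hL p hp hc P
  exact fun hdvd => P.not_dvd_index (hdvd.trans (index_dvd_of_le hP))

theorem not_dvd_card_sSup_normal (hp : p.Prime) :
    ¬ p ∣ Nat.card (sSup {N : Subgroup G | N.Normal ∧ ¬ p ∣ Nat.card N} : Subgroup G) := by
  refine (CompleteLattice.WellFoundedGT.isSupClosedCompact (Subgroup G) inferInstance
    {N : Subgroup G | N.Normal ∧ ¬ p ∣ Nat.card N} ⟨⊥, ?_⟩ ?_).2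
  · exact ⟨inferInstance, by simpa using hp.ne_one⟩
  · rintro M ⟨hM, hpM⟩ N ⟨hN, hpN⟩
    exact ⟨sup_normal M N, not_dvd_card_sup hp hpM hpN⟩

variable [Group.IsNilpotent G]

theorem normal_hallProduct : (hallProduct G c).Normal := by
  refine @iSup_normal _ _ _ _ fun q => @iSup_normal _ _ _ _ fun hq => ?_
  have := Fact.mk hq
  infer_instance

theorem of_prime_dvd_card_hallProduct (hp : p.Prime) (hdvd : p ∣ Nat.card (hallProduct G c)) :
    c p := by
  by_contra hc
  refine not_dvd_card_sSup_normal hp (hdvd.trans (card_dvd_of_le (hallProduct_le_iff.2 ?_)))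
  intro q hq hcq P
  have := Fact.mk hq
  refine le_sSup ⟨inferInstance, fun hpP => hc ?_⟩
  rw [P.card_eq_multiplicity] at hpP
  exact (Nat.prime_dvd_prime_iff_eq hp hq).1 (hp.dvd_of_dvd_pow hpP) ▸ hcq

theorem isHallPair_hallProduct
    (hc : ∀ q : ℕ, q.Prime → q ∣ Nat.card G → (c' q ↔ ¬ c q)) :
    IsHallPair (hallProduct G c) (hallProduct G c') where
  normal_left := normal_hallProduct
  normal_right := normal_hallProduct
  coprime := Nat.coprime_of_dvd fun q hq hdvd hdvd' =>
    (hc q hq (hdvd.trans (card_subgroup_dvd_card _))).1 (of_prime_dvd_card_hallProduct hq hdvd')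
      (of_prime_dvd_card_hallProduct hq hdvd)
  sup_eq_top := by
    by_contra htop
    obtain ⟨q, hq, hdvd⟩ := Nat.exists_prime_and_dvd (mt index_eq_one.1 htop)
    have hnot : ¬ c q := fun h => not_dvd_index_of_hallProduct_le le_sup_left hq h hdvd
    have hc'q : c' q := (hc q hq (hdvd.trans (index_dvd_card _))).2 hnot
    exact not_dvd_index_of_hallProduct_le le_sup_right hq hc'q hdvd

theorem hallProduct_eq_sylow [Fact p.Prime] (P : Sylow p G) : hallProduct G (· = p) = P := by
  refine le_antisymm (hallProduct_le_iff.2 ?_)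
    (hallProduct_le_iff (c := (· = p)).1 le_rfl p Fact.out rfl P)
  rintro _ _ rfl Q
  have := P.unique_of_normal inferInstance
  rw [Subsingleton.elim Q P]

theorem rank_hallProduct_eq_one (hp : p.Prime) (hdvd : p ∣ Nat.card G)
    (hsq : ¬ p ^ 2 ∣ Nat.card G) : Group.rank (hallProduct G (· = p)) = 1 := by
  have := Fact.mk hp
  let P : Sylow p G := default
  have hcard : Nat.card P = p := by
    have hone : (Nat.card G).factorization p = 1 := by
      have := (hp.dvd_iff_one_le_factorization Nat.card_pos.ne').1 hdvd
      have := mt (hp.pow_dvd_iff_le_factorization Nat.card_pos.ne').2 hsq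
      omega
    rw [P.card_eq_multiplicity, hone, pow_one]
  have : IsCyclic P := isCyclic_of_prime_card hcard
  have : Nontrivial P := Finite.one_lt_card_iff_nontrivial.1 (hp.one_lt.trans_eq hcard.symm)
  rw [rank_congr (hallProduct_eq_sylow P)]
  obtain ⟨g, hg⟩ := IsCyclic.exists_generator (α := P)
  refine le_antisymm (Group.rank_le (S := {g}) ?_) (Group.rank_pos P)
  rwa [Finset.coe_singleton, ← zpowers_eq_closure, eq_top_iff']

end HallProduct

section Coatom

variable {G : Type*} [Group G] {M : Subgroup G}

theorem isSimpleGroup_quotient_of_isCoatom [M.Normal] (hM : IsCoatom M) :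
    IsSimpleGroup (G ⧸ M) where
  exists_pair_ne := (QuotientGroup.nontrivial_iff.2 hM.1).exists_pair_ne
  eq_bot_or_eq_top_of_normal N _ := by
    have hinj := comap_injective (QuotientGroup.mk'_surjective M)
    refine ((hM.le_iff.1 (QuotientGroup.le_comap_mk' M N)).imp ?_ ?_).symm
    · exact fun h => hinj (h.trans (comap_top _).symm)
    · exact fun h => hinj (h.trans (QuotientGroup.ker_mk' M).symm)

theorem prime_index_of_isCoatom [Group.IsNilpotent G] (hM : IsCoatom M) : M.index.Prime := by
  have := Group.normalizerCondition_of_isNilpotent.normal_of_coatom M hM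
  have := isSimpleGroup_quotient_of_isCoatom hM
  exact CommGroup.is_simple_iff_prime_card.1 this

end Coatom

section Payoff

theorem payoff_self (p : Player) : payoff p p = 2 := by
  revert p; decide

theorem payoff_add_one (p : Player) : payoff p (p + 1) = 1 := by
  revert p; decide

theorem payoff_sub_one (p : Player) : payoff p (p - 1) = 0 := by
  revert p; decide

theorem payoff_le_two (p w : Player) : payoff p w ≤ 2 := by
  revert p w; decide

theorem payoff_le_one_of_ne {p w : Player} (h : w ≠ p) : payoff p w ≤ 1 := by
  revert p w; decide

theorem eq_sub_one_of_ne {p w : Player} (h : w ≠ p) (h' : w ≠ p + 1) : w = p - 1 := by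
  revert p w; decide

theorem payoff_injective (p : Player) : Function.Injective (payoff p) := by
  revert p; decide

end Payoff

namespace Position

variable {G : Type*} [Group G]

/-- The subgroup generated by the elements selected so far. -/
def span (h : Position G) : Subgroup G := closure {x | x ∈ h.selected}

/-- `h'` arises from `h` by a selection that does not end the game. -/
def Step (h h' : Position G) : Prop := ∃ x hx hgen, h.extend x hx hgen = h'

theorem step_extend (h : Position G) (x : G) (hx hgen) : h.Step (h.extend x hx hgen) :=
  ⟨x, hx, hgen, rfl⟩

theorem closure_cons_selected (h : Position G) (x : G) :
    closure {y | y ∈ x :: h.selected} = h.span ⊔ zpowers x := by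
  simp only [List.mem_cons, Set.ofPred_or, Subgroup.closure_union, Set.ofPred_eq_eq_singleton,
    ← zpowers_eq_closure, sup_comm (zpowers x), span]

theorem span_start [Nontrivial G] : (start G).span = ⊥ := by
  simp [span, start]

theorem toMove_start [Nontrivial G] : (start G).toMove = 1 := by
  simp [toMove, start]

theorem mem_span {h : Position G} {x : G} (hx : x ∈ h.selected) : x ∈ h.span :=
  subset_closure hx

theorem exists_notMem_selected (h : Position G) : ∃ x, x ∉ h.selected := by
  by_contra! hall
  exact h.not_generating (eq_top_iff.2 fun x _ => mem_span (hall x))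

theorem exists_step_span_eq {h : Position G} {x : G} (hx : x ∉ h.span)
    (htop : h.span ⊔ zpowers x ≠ ⊤) : ∃ h', h.Step h' ∧ h'.span = h.span ⊔ zpowers x := by
  rw [← closure_cons_selected] at htop ⊢
  exact ⟨h.extend x (mt mem_span hx) htop, h.step_extend x _ _, rfl⟩

namespace Step

variable {h h' : Position G}

theorem length_eq (hs : h.Step h') : h'.selected.length = h.selected.length + 1 := by
  obtain ⟨x, hx, hgen, rfl⟩ := hs
  exact List.length_cons

theorem toMove_eq (hs : h.Step h') : h'.toMove = h.toMove + 1 := by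
  rw [toMove, hs.length_eq, Nat.cast_add_one, toMove]

theorem exists_span_eq (hs : h.Step h') : ∃ x, h'.span = h.span ⊔ zpowers x := by
  obtain ⟨x, hx, hgen, rfl⟩ := hs
  exact ⟨x, h.closure_cons_selected x⟩

theorem span_le (hs : h.Step h') : h.span ≤ h'.span := by
  obtain ⟨x, hx⟩ := hs.exists_span_eq
  exact hx ▸ le_sup_left

end Step

variable [Finite G]

theorem Step.measure_lt {h h' : Position G} (hs : h.Step h') :
    Nat.card G - h'.selected.length < Nat.card G - h.selected.length := by
  obtain ⟨x, hx, hgen, rfl⟩ := hs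
  exact h.extend_measure_lt x hx hgen

theorem backward_induction {motive : Position G → Prop}
    (step : ∀ h : Position G, (∀ h', h.Step h' → motive h') → motive h) (h : Position G) :
    motive h := by
  induction hn : Nat.card G - h.selected.length using Nat.strong_induction_on generalizing h with
  | _ n ih =>
    subst hn
    exact step h fun h' hs => ih _ hs.measure_lt h' rfl

end Position

section Value

variable {G : Type*} [Group G]

open Classical in
/-- The winner of the game after `x` is selected at `h`, if `v` gives the winners at the positions
that follow. -/
noncomputable def Position.outcome (v : Position G → Player) (h : Position G) (x : G)
    (hx : x ∉ h.selected) : Player :=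
  if hgen : closure {y | y ∈ x :: h.selected} = ⊤ then h.toMove - 1 else v (h.extend x hx hgen)

theorem Position.outcome_congr {v w : Position G → Player} {h : Position G}
    (hvw : ∀ h', h.Step h' → v h' = w h') (x : G) (hx : x ∉ h.selected) :
    h.outcome v x hx = h.outcome w x hx := by
  unfold outcome
  split_ifs with hgen
  · rfl
  · exact hvw _ (h.step_extend x hx hgen)

theorem Position.payoff_outcome_mono {v w : Position G → Player} {h : Position G} {i : Player}
    (hvw : ∀ h', h.Step h' → payoff i (v h') ≤ payoff i (w h')) (x : G) (hx : x ∉ h.selected) :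
    payoff i (h.outcome v x hx) ≤ payoff i (h.outcome w x hx) := by
  unfold outcome
  split_ifs with hgen
  · exact le_rfl
  · exact hvw _ (h.step_extend x hx hgen)

variable [Finite G]

open Classical in
/-- The winner under rational play, by backward induction: the player to move wins if she can move
to a position that she wins; otherwise she is the runner-up if she can move to a position won by the
next player; otherwise she loses. -/
noncomputable def value {G : Type*} [Group G] [Finite G] (h : Position G) : Player :=
  if ∃ h', ∃ _ : h.Step h', value h' = h.toMove then h.toMove
  else if ∃ h', ∃ _ : h.Step h', value h' = h.toMove + 1 then h.toMove + 1
  else h.toMove - 1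
termination_by Nat.card G - h.selected.length
decreasing_by all_goals exact Position.Step.measure_lt ‹_›

theorem payoff_value_le_of_step {h h' : Position G} (hs : h.Step h') :
    payoff h.toMove (value h') ≤ payoff h.toMove (value h) := by
  rw [value.eq_1 h]
  split_ifs with hwin hnext
  · exact payoff_self h.toMove ▸ payoff_le_two _ _
  · rw [payoff_add_one]
    exact payoff_le_one_of_ne fun e => hwin ⟨h', hs, e⟩
  · rw [eq_sub_one_of_ne (fun e => hwin ⟨h', hs, e⟩) fun e => hnext ⟨h', hs, e⟩]

theorem payoff_outcome_value_le (h : Position G) (x : G) (hx : x ∉ h.selected) :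
    payoff h.toMove (h.outcome value x hx) ≤ payoff h.toMove (value h) := by
  unfold Position.outcome
  split_ifs with hgen
  · exact payoff_sub_one h.toMove ▸ Nat.zero_le _
  · exact payoff_value_le_of_step (h.step_extend x hx hgen)

theorem value_eq_of_forall_not_step {h : Position G} (hend : ∀ h', ¬ h.Step h') :
    value h = h.toMove - 1 := by
  rw [value, if_neg, if_neg]
  all_goals exact fun ⟨h', hs, _⟩ => hend h' hs

theorem exists_step_value_eq {h h₀ : Position G} (hs₀ : h.Step h₀) :
    ∃ h', h.Step h' ∧ value h' = value h := by
  simp only [← exists_prop]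
  rw [value.eq_1 h]
  split_ifs with hwin hnext
  · exact hwin
  · exact hnext
  · exact ⟨h₀, hs₀, eq_sub_one_of_ne (fun e => hwin ⟨h₀, hs₀, e⟩) fun e => hnext ⟨h₀, hs₀, e⟩⟩

theorem exists_outcome_value_eq (h : Position G) : ∃ x hx, h.outcome value x hx = value h := by
  by_cases hend : ∃ h', h.Step h'
  · obtain ⟨_, hs₀⟩ := hend
    obtain ⟨_, ⟨x, hx, hgen, rfl⟩, hval⟩ := exists_step_value_eq hs₀
    exact ⟨x, hx, (dif_neg hgen).trans hval⟩
  · rw [not_exists] at hend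
    obtain ⟨x, hx⟩ := h.exists_notMem_selected
    refine ⟨x, hx, (dif_pos ?_).trans (value_eq_of_forall_not_step hend).symm⟩
    by_contra hgen
    exact hend _ (h.step_extend x hx hgen)

end Value

section Rationality

variable {G : Type*} [Group G]

open Classical in
/-- The strategy that selects `x` at `h` and follows `s` at all other positions. -/
noncomputable def Strategy.deviate (s : Strategy G) (h : Position G) (x : G)
    (hx : x ∉ h.selected) : Strategy G where
  move h' := if h' = h then x else s.move h'
  legal h' := by
    split_ifs with heq
    · exact heq ▸ hx
    · exact s.legal h'

theorem Strategy.deviate_move_self (s : Strategy G) (h : Position G) (x : G)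
    (hx : x ∉ h.selected) : (s.deviate h x hx).move h = x :=
  if_pos rfl

theorem Strategy.deviate_move_of_ne (s : Strategy G) {h h' : Position G} (hne : h' ≠ h) (x : G)
    (hx : x ∉ h.selected) : (s.deviate h x hx).move h' = s.move h' :=
  if_neg hne

variable [Finite G]

theorem winner_eq_outcome (σ : Profile G) (h : Position G) :
    winner σ h = h.outcome (winner σ) ((σ h.toMove).move h) ((σ h.toMove).legal h) := by
  rw [winner, Position.outcome]

theorem payoff_winner_le_payoff_value {σ : Profile G} {i : Player}
    (hσ : ∀ h : Position G, h.toMove ≠ i →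
      h.outcome value ((σ h.toMove).move h) ((σ h.toMove).legal h) = value h) (h : Position G) :
    payoff i (winner σ h) ≤ payoff i (value h) := by
  induction h using Position.backward_induction with
  | step h ih =>
    rw [winner_eq_outcome]
    refine (Position.payoff_outcome_mono ih _ _).trans ?_
    obtain rfl | hi := eq_or_ne h.toMove i
    · exact payoff_outcome_value_le h _ _
    · rw [hσ h hi]

theorem exists_isRational (G : Type*) [Group G] [Finite G] : ∃ σ : Profile G, IsRational σ := by
  choose m hm hval using exists_outcome_value_eq (G := G)
  let σ : Profile G := fun _ => ⟨m, hm⟩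
  have hwin (h : Position G) : winner σ h = value h := by
    induction h using Position.backward_induction with
    | step h ih =>
      rw [winner_eq_outcome, h.outcome_congr ih]
      exact hval h
  refine ⟨σ, fun h i τ => ?_⟩
  rw [hwin]
  refine payoff_winner_le_payoff_value (fun h' hi => ?_) h
  simp only [Function.update_of_ne hi]
  exact hval h'

theorem winner_congr {σ τ : Profile G} {h : Position G}
    (hστ : ∀ (i : Player) (h' : Position G), h.selected.length ≤ h'.selected.length →
      (σ i).move h' = (τ i).move h') : winner σ h = winner τ h := by
  induction h using Position.backward_induction with
  | step h ih =>
    have hstep (h' : Position G) (hs : h.Step h') : winner σ h' = winner τ h' :=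
      ih h' hs fun i h'' hle => hστ i h'' (by have := hs.length_eq; omega)
    simp only [winner_eq_outcome _ h, hστ h.toMove h le_rfl, h.outcome_congr hstep]

theorem IsRational.payoff_outcome_winner_le {σ : Profile G} (hσ : IsRational σ) (h : Position G)
    (x : G) (hx : x ∉ h.selected) :
    payoff h.toMove (h.outcome (winner σ) x hx) ≤ payoff h.toMove (winner σ h) := by
  let τ : Profile G := Function.update σ h.toMove ((σ h.toMove).deviate h x hx)
  have hx' : (τ h.toMove).move h = x := by
    simp only [τ, Function.update_self, Strategy.deviate_move_self]
  have hlater (h' : Position G) (hs : h.Step h') : winner τ h' = winner σ h' := by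
    refine winner_congr fun i h'' hle => ?_
    have hne : h'' ≠ h := by
      rintro rfl
      have := hs.length_eq
      omega
    obtain rfl | hi := eq_or_ne i h.toMove
    · simp only [τ, Function.update_self, Strategy.deviate_move_of_ne _ hne]
    · simp only [τ, Function.update_of_ne hi]
  have hτ : winner τ h = h.outcome (winner σ) x hx := by
    simp only [winner_eq_outcome τ h, hx', h.outcome_congr hlater]
  exact hτ ▸ hσ h h.toMove _

theorem IsRational.winner_eq_value {σ : Profile G} (hσ : IsRational σ) (h : Position G) :
    winner σ h = value h := by
  induction h using Position.backward_induction with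
  | step h ih =>
    apply payoff_injective h.toMove
    apply le_antisymm
    · rw [winner_eq_outcome, h.outcome_congr ih]
      exact payoff_outcome_value_le h _ _
    · obtain ⟨x, hx, hval⟩ := exists_outcome_value_eq h
      rw [← hval, ← h.outcome_congr ih]
      exact hσ.payoff_outcome_winner_le h x hx

theorem hasWinningStrategy_of_value_start [Nontrivial G] {i : Player}
    (h : value (Position.start G) = i) : HasWinningStrategy G i :=
  ⟨exists_isRational G, fun _ hσ => (hσ.winner_eq_value _).trans h⟩

theorem exists_isCoatom_value_eq (h : Position G) :
    ∃ M : Subgroup G, IsCoatom M ∧ h.span ≤ M ∧ value h = (Nat.card M : ZMod 3) := by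
  induction h using Position.backward_induction with
  | step h ih =>
    by_cases hend : ∃ h', h.Step h'
    · obtain ⟨_, hs₀⟩ := hend
      obtain ⟨h', hs, hval⟩ := exists_step_value_eq hs₀
      obtain ⟨M, hM, hle, hcard⟩ := ih h' hs
      exact ⟨M, hM, hs.span_le.trans hle, hval ▸ hcard⟩
    · rw [not_exists] at hend
      obtain ⟨M, hM, hle⟩ := (eq_top_or_exists_le_coatom h.span).resolve_left h.not_generating
      refine ⟨M, hM, hle, ?_⟩
      have hmem (x : G) : x ∈ M ↔ x ∈ h.selected := by
        refine ⟨fun hx => ?_, fun hx => hle (Position.mem_span hx)⟩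
        by_contra hns
        refine hend _ (h.step_extend x hns (ne_top_of_le_ne_top hM.1 ?_))
        exact h.closure_cons_selected x ▸ sup_le hle (zpowers_le.2 hx)
      have hcard : Nat.card M = h.selected.length := by
        classical
        rw [← List.toFinset_card_of_nodup h.nodup]
        exact Nat.subtype_card _ fun x => List.mem_toFinset.trans (hmem x).symm
      rw [value_eq_of_forall_not_step hend, hcard, Position.toMove, add_sub_cancel_right]

end Rationality


section Race

variable {G : Type*} [Group G] {A B : Subgroup G} {a : Player}

/-- A Hall pair such that, modulo `3`, every maximal subgroup containing `A` has order `a` and every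
maximal subgroup containing `B` has order `a + 1`. The game is then a race between `A` and `B`:
Player `a` wins if `A` is completed first, and Player `a + 1` if `B` is. -/
structure IsRace (A B : Subgroup G) (a : Player) : Prop extends IsHallPair A B where
  card_of_left_le : ∀ M : Subgroup G, IsCoatom M → A ≤ M → (Nat.card M : ZMod 3) = a
  card_of_right_le : ∀ M : Subgroup G, IsCoatom M → B ≤ M → (Nat.card M : ZMod 3) = a + 1

/-- The players `a - 1` and `a` both want `A` to be completed first, and Player `a + 1` wants `B` to
be, so that two selections for `A` alternate with one for `B`. The first two win this race exactly
if the elements missing from `A` are at most twice those missing from `B`, after a handicap for the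
number of their selections already made in the current round. -/
def Leads (A B : Subgroup G) (a : Player) (h : Position G) : Prop :=
  relRank A h.span + (h.toMove - a + 1).val ≤ 2 * relRank B h.span

theorem not_leads_of_eq_zero {h : Position G} (hA : relRank A h.span ≠ 0)
    (hB : relRank B h.span = 0) : ¬ Leads A B a h := by
  unfold Leads
  omega

theorem val_toMove_succ {a p : Player} (hp : p ≠ a + 1) :
    (p + 1 - a + 1).val = (p - a + 1).val + 1 := by
  revert a p; decide

theorem val_add_one_sub (a : Player) : (a + 1 - a + 1).val = 2 := by
  revert a; decide

theorem val_add_one_add_one_sub (a : Player) : (a + 1 + 1 - a + 1).val = 0 := by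
  revert a; decide

theorem eq_of_payoff_le {a p w : Player} (hp : p ≠ a + 1) (hw : w = a ∨ w = a + 1)
    (hle : payoff p a ≤ payoff p w) : w = a := by
  revert a p w; decide

theorem payoff_add_one_lt (a : Player) : payoff (a + 1) a < payoff (a + 1) (a + 1) := by
  revert a; decide

theorem player_ne_add_one (a : Player) : a ≠ a + 1 := by
  revert a; decide

variable [Finite G]

theorem Position.Step.relRank_le {h h' : Position G} (hs : h.Step h') (A : Subgroup G) :
    relRank A h'.span ≤ relRank A h.span :=
  relRank_anti_right hs.span_le

theorem Position.Step.relRank_le_add_one {h h' : Position G} (hs : h.Step h') (A : Subgroup G) :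
    relRank A h.span ≤ relRank A h'.span + 1 := by
  obtain ⟨x, hx⟩ := hs.exists_span_eq
  exact hx ▸ relRank_le_relRank_sup_zpowers_add_one A h.span x

theorem IsHallPair.exists_step (hAB : IsHallPair A B) {h : Position G} (hA : relRank A h.span ≠ 0)
    (hB : relRank B h.span ≠ 0) :
    ∃ h', h.Step h' ∧ relRank A h'.span < relRank A h.span ∧
      relRank B h'.span = relRank B h.span := by
  obtain ⟨x, hx, hlt⟩ := hAB.exists_mem_relRank_sup_zpowers_le h.span
  replace hlt : relRank A (h.span ⊔ zpowers x) < relRank A h.span := by omega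
  have hBx : relRank B (h.span ⊔ zpowers x) = relRank B h.span :=
    hAB.symm.relRank_sup_eq (zpowers_le.2 hx)
  have hnew : x ∉ h.span := fun hmem => hlt.ne (by rw [sup_eq_left.2 (zpowers_le.2 hmem)])
  have htop : h.span ⊔ zpowers x ≠ ⊤ := fun htop =>
    hB (hBx ▸ htop ▸ relRank_eq_zero_iff.2 le_top)
  obtain ⟨h', hs, hspan⟩ := Position.exists_step_span_eq hnew htop
  exact ⟨h', hs, hspan ▸ hlt, hspan ▸ hBx⟩

namespace IsRace

variable {h : Position G}

theorem value_eq_of_left_le (r : IsRace A B a) (hA : A ≤ h.span) : value h = a := by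
  obtain ⟨M, hM, hle, hval⟩ := exists_isCoatom_value_eq h
  exact hval.trans (r.card_of_left_le M hM (hA.trans hle))

theorem value_eq_of_right_le (r : IsRace A B a) (hB : B ≤ h.span) : value h = a + 1 := by
  obtain ⟨M, hM, hle, hval⟩ := exists_isCoatom_value_eq h
  exact hval.trans (r.card_of_right_le M hM (hB.trans hle))

theorem value_eq_or (r : IsRace A B a) (h : Position G) : value h = a ∨ value h = a + 1 := by
  obtain ⟨M, hM, -, hval⟩ := exists_isCoatom_value_eq h
  exact (r.le_or_le_of_isCoatom hM).imp (fun hA => hval.trans (r.card_of_left_le M hM hA))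
    fun hB => hval.trans (r.card_of_right_le M hM hB)

theorem value_eq_iff_of_toMove_ne (r : IsRace A B a) (hp : h.toMove ≠ a + 1)
    (hstep : ∃ h', h.Step h') : value h = a ↔ ∃ h', h.Step h' ∧ value h' = a := by
  obtain ⟨_, hs₀⟩ := hstep
  constructor
  · rintro hval
    exact hval ▸ exists_step_value_eq hs₀
  · rintro ⟨h', hs, hval⟩
    exact eq_of_payoff_le hp (r.value_eq_or h) (hval ▸ payoff_value_le_of_step hs)

theorem value_eq_iff_of_toMove_eq (r : IsRace A B a) (hp : h.toMove = a + 1)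
    (hstep : ∃ h', h.Step h') : value h = a ↔ ∀ h', h.Step h' → value h' = a := by
  obtain ⟨_, hs₀⟩ := hstep
  constructor
  · intro hval h' hs
    refine (r.value_eq_or h').resolve_right fun hval' => ?_
    have hle := payoff_value_le_of_step hs
    rw [hp, hval, hval'] at hle
    exact (payoff_add_one_lt a).not_ge hle
  · intro hall
    obtain ⟨h', hs, hval⟩ := exists_step_value_eq hs₀
    exact hval ▸ hall h' hs

end IsRace

theorem IsHallPair.leads_of_eq_zero (hAB : IsHallPair A B) {h : Position G}
    (hA : relRank A h.span = 0) : Leads A B a h := by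
  have hB : relRank B h.span ≠ 0 := by
    rw [Ne, relRank_eq_zero_iff]
    intro hB
    exact h.not_generating
      (top_le_iff.1 (hAB.sup_eq_top.ge.trans (sup_le (relRank_eq_zero_iff.1 hA) hB)))
  have := ZMod.val_lt (h.toMove - a + 1)
  unfold Leads
  omega

theorem IsHallPair.leads_iff_of_toMove_ne (hAB : IsHallPair A B) {h : Position G}
    (hA : relRank A h.span ≠ 0) (hB : relRank B h.span ≠ 0) (hp : h.toMove ≠ a + 1) :
    Leads A B a h ↔ ∃ h', h.Step h' ∧ Leads A B a h' := by
  have hoffset {h' : Position G} (hs : h.Step h') :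
      (h'.toMove - a + 1).val = (h.toMove - a + 1).val + 1 := hs.toMove_eq ▸ val_toMove_succ hp
  unfold Leads
  constructor
  · intro hlead
    obtain ⟨h', hs, hA', hB'⟩ := hAB.exists_step hA hB
    exact ⟨h', hs, by rw [hoffset hs]; omega⟩
  · rintro ⟨h', hs, hlead⟩
    have := hs.relRank_le_add_one A
    have := hs.relRank_le B
    rw [hoffset hs] at hlead
    omega

theorem IsHallPair.leads_iff_of_toMove_eq (hAB : IsHallPair A B) {h : Position G}
    (hA : relRank A h.span ≠ 0) (hB : relRank B h.span ≠ 0) (hp : h.toMove = a + 1) :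
    Leads A B a h ↔ ∀ h', h.Step h' → Leads A B a h' := by
  have hoffset : (h.toMove - a + 1).val = 2 := hp ▸ val_add_one_sub a
  have hoffset' {h' : Position G} (hs : h.Step h') : (h'.toMove - a + 1).val = 0 := by
    rw [hs.toMove_eq, hp, val_add_one_add_one_sub]
  unfold Leads
  constructor
  · intro hlead h' hs
    have := hs.relRank_le A
    have := hs.relRank_le_add_one B
    rw [hoffset' hs]
    omega
  · intro hlead
    obtain ⟨h', hs, hB', hA'⟩ := hAB.symm.exists_step hB hA
    have := hlead h' hs
    rw [hoffset' hs] at this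
    omega

namespace IsRace

theorem value_eq_iff_leads (r : IsRace A B a) (h : Position G) :
    value h = a ↔ Leads A B a h := by
  induction h using Position.backward_induction with
  | step h ih =>
    by_cases hA : relRank A h.span = 0
    · exact iff_of_true (r.value_eq_of_left_le (relRank_eq_zero_iff.1 hA)) (r.leads_of_eq_zero hA)
    by_cases hB : relRank B h.span = 0
    · have hval := r.value_eq_of_right_le (relRank_eq_zero_iff.1 hB)
      exact iff_of_false (hval ▸ (player_ne_add_one a).symm) (not_leads_of_eq_zero hA hB)
    have hstep : ∃ h', h.Step h' := (r.exists_step hA hB).imp fun _ => And.left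
    by_cases hp : h.toMove = a + 1
    · rw [r.value_eq_iff_of_toMove_eq hp hstep, r.leads_iff_of_toMove_eq hA hB hp]
      exact forall₂_congr ih
    · rw [r.value_eq_iff_of_toMove_ne hp hstep, r.leads_iff_of_toMove_ne hA hB hp]
      exact exists_congr fun h' => and_congr_right (ih h')

variable [Nontrivial G]

theorem leads_start_iff (r : IsRace A B a) :
    Leads A B a (Position.start G) ↔ Group.rank A + (2 - a).val ≤ 2 * Group.rank B := by
  rw [Leads, Position.span_start, Position.toMove_start, r.relRank_bot, r.symm.relRank_bot,
    sub_add_eq_add_sub, one_add_one_eq_two]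

theorem hasWinningStrategy_left (r : IsRace A B a)
    (hle : Group.rank A + (2 - a).val ≤ 2 * Group.rank B) : HasWinningStrategy G a :=
  hasWinningStrategy_of_value_start ((r.value_eq_iff_leads _).2 (r.leads_start_iff.2 hle))

theorem hasWinningStrategy_right (r : IsRace A B a)
    (hlt : 2 * Group.rank B < Group.rank A + (2 - a).val) : HasWinningStrategy G (a + 1) := by
  refine hasWinningStrategy_of_value_start ((r.value_eq_or _).resolve_left fun hval => ?_)
  exact hlt.not_ge (r.leads_start_iff.1 ((r.value_eq_iff_leads _).1 hval))

end IsRace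

end Race

section Nilpotent

variable {G : Type*} [Group G]

theorem natCast_card_eq_mul {M : Subgroup G} {i j : ℕ} (hG : Nat.card G ≡ i [MOD 3])
    (hM : M.index ≡ j [MOD 3]) (hj : ¬ 3 ∣ j) : (Nat.card M : ZMod 3) = i * j := by
  have hcancel : ∀ x y : ZMod 3, y ≠ 0 → x * y * y = x := by decide
  rw [← ZMod.natCast_eq_natCast_iff] at hG hM
  rw [← ZMod.natCast_eq_zero_iff] at hj
  rw [← hG, ← M.card_mul_index, Nat.cast_mul, hM, hcancel _ _ hj]

theorem modEq_one_iff_not_modEq_two {n q : ℕ} (hn : ¬ 3 ∣ n) (hdvd : q ∣ n) :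
    q ≡ 1 [MOD 3] ↔ ¬ q ≡ 2 [MOD 3] := by
  have : ¬ 3 ∣ q := fun h => hn (h.trans hdvd)
  unfold Nat.ModEq
  omega

theorem not_three_dvd_of_prime {q : ℕ} (hq : q.Prime) (hne : q ≠ 3) : ¬ 3 ∣ q := fun h =>
  hne ((Nat.prime_dvd_prime_iff_eq Nat.prime_three hq).1 h).symm

theorem natCast_card_eq_zero_of_index_ne_three {M : Subgroup G} (hG : 3 ∣ Nat.card G)
    (hM : M.index.Prime) (hne : M.index ≠ 3) : (Nat.card M : ZMod 3) = 0 := by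
  have := natCast_card_eq_mul (Nat.modEq_zero_iff_dvd.2 hG) (Nat.ModEq.refl M.index)
    (not_three_dvd_of_prime hM hne)
  rw [this, Nat.cast_zero, zero_mul]

theorem natCast_card_eq_of_index_eq_three {M : Subgroup G} {k : ℕ}
    (hG : Nat.card G ≡ 3 * k [MOD 9]) (hM : M.index = 3) : (Nat.card M : ZMod 3) = k := by
  have hmul := M.card_mul_index
  rw [hM] at hmul
  rw [ZMod.natCast_eq_natCast_iff]
  unfold Nat.ModEq at hG ⊢
  omega

variable [Finite G] [Group.IsNilpotent G]

theorem isRace_hallProduct {c c' : ℕ → Prop} {a : Player}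
    (hc : ∀ q : ℕ, q.Prime → q ∣ Nat.card G → (c' q ↔ ¬ c q))
    (hc'M : ∀ M : Subgroup G, M.index.Prime → c' M.index → (Nat.card M : ZMod 3) = a)
    (hcM : ∀ M : Subgroup G, M.index.Prime → c M.index → (Nat.card M : ZMod 3) = a + 1) :
    IsRace (hallProduct G c) (hallProduct G c') a where
  toIsHallPair := isHallPair_hallProduct hc
  card_of_left_le M hM hle := by
    have hp := prime_index_of_isCoatom hM
    refine hc'M M hp ((hc _ hp M.index_dvd_card).2 fun h => ?_)
    exact not_dvd_index_of_hallProduct_le hle hp h dvd_rfl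
  card_of_right_le M hM hle := by
    have hp := prime_index_of_isCoatom hM
    refine hcM M hp (of_not_not fun h => ?_)
    exact not_dvd_index_of_hallProduct_le hle hp ((hc _ hp M.index_dvd_card).2 h) dvd_rfl

theorem isRace_of_card_modEq_one (hG : Nat.card G ≡ 1 [MOD 3]) :
    IsRace (sylowProduct G 2) (sylowProduct G 1) 1 := by
  have h3 : ¬ 3 ∣ Nat.card G := fun h => by
    unfold Nat.ModEq at hG
    omega
  exact isRace_hallProduct (fun q _ hdvd => modEq_one_iff_not_modEq_two h3 hdvd)
    (fun M _ hM => (natCast_card_eq_mul hG hM (by decide)).trans (by decide))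
    (fun M _ hM => (natCast_card_eq_mul hG hM (by decide)).trans (by decide))

theorem isRace_of_card_modEq_two (hG : Nat.card G ≡ 2 [MOD 3]) :
    IsRace (sylowProduct G 1) (sylowProduct G 2) 1 := by
  have h3 : ¬ 3 ∣ Nat.card G := fun h => by
    unfold Nat.ModEq at hG
    omega
  exact isRace_hallProduct
    (fun q _ hdvd => iff_not_comm.1 (modEq_one_iff_not_modEq_two h3 hdvd))
    (fun M _ hM => (natCast_card_eq_mul hG hM (by decide)).trans (by decide))
    (fun M _ hM => (natCast_card_eq_mul hG hM (by decide)).trans (by decide))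

theorem isRace_of_card_modEq_three (hG : Nat.card G ≡ 3 [MOD 9]) :
    IsRace (hallProduct G (· = 3)) (hallProduct G (· ≠ 3)) 0 := by
  have h3 : 3 ∣ Nat.card G := by
    unfold Nat.ModEq at hG
    omega
  refine isRace_hallProduct (fun _ _ _ => Iff.rfl)
    (fun M hp hne => natCast_card_eq_zero_of_index_ne_three h3 hp hne) fun M _ heq => ?_
  exact (natCast_card_eq_of_index_eq_three (k := 1) hG heq).trans (by decide)

theorem isRace_of_card_modEq_six (hG : Nat.card G ≡ 6 [MOD 9]) :
    IsRace (hallProduct G (· ≠ 3)) (hallProduct G (· = 3)) 2 := by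
  have h3 : 3 ∣ Nat.card G := by
    unfold Nat.ModEq at hG
    omega
  refine isRace_hallProduct (fun _ _ _ => not_not.symm)
    (fun M _ heq => natCast_card_eq_of_index_eq_three (k := 2) hG heq) fun M hp hne => ?_
  exact (natCast_card_eq_zero_of_index_ne_three h3 hp hne).trans (by decide)

theorem rank_hallProduct_three_eq_one {k : ℕ} (hk : ¬ 3 ∣ k) (hG : Nat.card G ≡ 3 * k [MOD 9]) :
    Group.rank (hallProduct G (· = 3)) = 1 := by
  unfold Nat.ModEq at hG
  exact rank_hallProduct_eq_one Nat.prime_three (by omega) (by omega)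

variable [Nontrivial G]

theorem hasWinningStrategy_three_of_nine_dvd (hG : 9 ∣ Nat.card G) :
    HasWinningStrategy G 3 := by
  obtain ⟨M, hM, -, hval⟩ := exists_isCoatom_value_eq (Position.start G)
  refine hasWinningStrategy_of_value_start (hval.trans ?_)
  by_cases h3 : M.index = 3
  · exact natCast_card_eq_of_index_eq_three (k := 3) (by unfold Nat.ModEq; omega) h3
  · exact natCast_card_eq_zero_of_index_ne_three (by omega) (prime_index_of_isCoatom hM) h3

theorem hasWinningStrategy_one_of_card_modEq_three (hG : Nat.card G ≡ 3 [MOD 9])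
    (hrank : Group.rank G ≤ 1) : HasWinningStrategy G 1 := by
  have r := isRace_of_card_modEq_three hG
  have hone := rank_hallProduct_three_eq_one (k := 1) (by decide) hG
  rw [r.rank_eq_max] at hrank
  refine r.hasWinningStrategy_right ?_
  change _ < _ + 2
  omega

theorem hasWinningStrategy_three_of_card_modEq_three (hG : Nat.card G ≡ 3 [MOD 9])
    (hrank : 2 ≤ Group.rank G) : HasWinningStrategy G 3 := by
  have r := isRace_of_card_modEq_three hG
  have hone := rank_hallProduct_three_eq_one (k := 1) (by decide) hG
  rw [r.rank_eq_max] at hrank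
  refine r.hasWinningStrategy_left ?_
  change _ + 2 ≤ _
  omega

theorem hasWinningStrategy_two_of_card_modEq_six (hG : Nat.card G ≡ 6 [MOD 9])
    (hrank : Group.rank G ≤ 2) : HasWinningStrategy G 2 := by
  have r := isRace_of_card_modEq_six hG
  have hone := rank_hallProduct_three_eq_one (k := 2) (by decide) hG
  rw [r.rank_eq_max] at hrank
  refine r.hasWinningStrategy_left ?_
  change _ + 0 ≤ _
  omega

theorem hasWinningStrategy_three_of_card_modEq_six (hG : Nat.card G ≡ 6 [MOD 9])
    (hrank : 3 ≤ Group.rank G) : HasWinningStrategy G 3 := by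
  have r := isRace_of_card_modEq_six hG
  have hone := rank_hallProduct_three_eq_one (k := 2) (by decide) hG
  rw [r.rank_eq_max] at hrank
  refine r.hasWinningStrategy_right ?_
  change _ < _ + 0
  omega

end Nilpotent

end DoNotGenerate

open DoNotGenerate in
theorem mainTheorem1 (G : Type*) [Group G] [Finite G] [Nontrivial G] [Group.IsNilpotent G]
    (H K : Subgroup G) (hH : H = sylowProduct G 1) (hK : K = sylowProduct G 2) :
    ((Nat.card G ≡ 1 [MOD 3] ∧ 2 * Group.rank H ≥ Group.rank K + 1 ∨
      Nat.card G ≡ 2 [MOD 3] ∧ 2 * Group.rank K ≥ Group.rank H + 1 ∨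
      Nat.card G ≡ 3 [MOD 9] ∧ Group.rank G = 1) → HasWinningStrategy G 1) ∧
    ((Nat.card G ≡ 1 [MOD 3] ∧ 2 * Group.rank H < Group.rank K + 1 ∨
      Nat.card G ≡ 2 [MOD 3] ∧ 2 * Group.rank K < Group.rank H + 1 ∨
      Nat.card G ≡ 6 [MOD 9] ∧ Group.rank G ≤ 2) → HasWinningStrategy G 2) ∧
    ((Nat.card G ≡ 0 [MOD 9] ∨
      Nat.card G ≡ 3 [MOD 9] ∧ Group.rank G ≥ 2 ∨
      Nat.card G ≡ 6 [MOD 9] ∧ Group.rank G ≥ 3) → HasWinningStrategy G 3) := by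
  subst hH hK
  refine ⟨?_, ?_, ?_⟩
  · rintro (⟨hG, hle⟩ | ⟨hG, hle⟩ | ⟨hG, hrank⟩)
    · exact (isRace_of_card_modEq_one hG).hasWinningStrategy_left hle
    · exact (isRace_of_card_modEq_two hG).hasWinningStrategy_left hle
    · exact hasWinningStrategy_one_of_card_modEq_three hG hrank.le
  · rintro (⟨hG, hlt⟩ | ⟨hG, hlt⟩ | ⟨hG, hrank⟩)
    · exact (isRace_of_card_modEq_one hG).hasWinningStrategy_right hlt
    · exact (isRace_of_card_modEq_two hG).hasWinningStrategy_right hlt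
    · exact hasWinningStrategy_two_of_card_modEq_six hG hrank
  · rintro (hG | ⟨hG, hrank⟩ | ⟨hG, hrank⟩)
    · exact hasWinningStrategy_three_of_nine_dvd (Nat.modEq_zero_iff_dvd.1 hG)
    · exact hasWinningStrategy_three_of_card_modEq_three hG hrank
    · exact hasWinningStrategy_three_of_card_modEq_six hG hrank
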